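/- Let $\Gamma$ be a countable discrete group. A function $\phi:\Gamma\to\mathbb{C}$ is positive definite if $\sum_{i,j}\overline{\alpha_i}\alpha_j\phi(g_i^{-1}g_j)\ge 0$ for all $n\in\mathbb{N}$, $g_1,\dots,g_n\in\Gamma$ and $\alpha_1,\dots,\alpha_n\in\mathbb{C}$, and normalized if $\phi(e)=1$; let $\mathcal{P}(\Gamma)\subset\ell^\infty(\Gamma)$ be the set of normalized positive definite functions with the weak-$*$ topology (equivalently, the topology of pointwise convergence), on which $\Gamma$ acts by conjugation. A character is a conjugation-invariant element of $\mathcal{P}(\Gamma)$; it is extremal if it is not of the form $\alpha\phi_1+(1-\alpha)\phi_2$ with $0<\alpha<1$ and distinct characters $\phi_1,\phi_2$. A character with GNS representation $(\pi,H)$ is called amenable if $\pi\otimes\bar\pi$ weakly contains the trivial representation; von Neumann amenable if moreover $\pi(\Gamma)''$ is an amenable von Neumann algebra (there is a conditional expectation of $B(H)$ onto it); and finite if $\dim H<\infty$. Let $\mathrm{Rad}(\Gamma)$ be the amenable radical, the largest amenable normal subgroup of $\Gamma$. The group $\Gamma$ is charfinite if 1. every non-empty $\Gamma$-invariant compact convex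 subset of $\mathcal{P}(\Gamma)$ contains a fixed point (a character); 2. every extremal character of $\Gamma$ is either supported on $\mathrm{Rad}(\Gamma)$ or von Neumann amenable; 3. $\mathrm{Rad}(\Gamma)$ is finite; 4. $\Gamma$ has only finitely many isomorphism classes of unitary representations in each given finite dimension; 5. every amenable extremal character of $\Gamma$ is finite. If $\Gamma$ is generated by a finite set $S$, with word length $\ell_S$, an element $\gamma\in\Gamma$ is called distorted if $\liminf_{n\to\infty}\ell_S(\gamma^n)/n=0$ (this does not depend on $S$). **Proposition.** Let $\Gamma$ be a finitely generated charfinite group such that $\mathrm{Rad}(\Gamma)=\{e\}$ and such that $\Gamma$ contains a distorted element of infinite order. Then $\Gamma$ has non-factorizable regular character: if $\phi,\psi$ are characters on $\Gamma$ with $\phi(s)\psi(s)=0$ for all $s\in\Gamma\setminus\{e\}$, then $\phi=\delta_e$ or $\psi=\delta_e$, where $\delta_e(e)=1$ and $\delta_e(s)=0$ for $s\ne e$. -/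

import Mathlib

open scoped ComplexOrder TensorProduct ComplexConjugate

noncomputable section

namespace NFRC

universe u v w

/-! ### Positive definite functions and characters -/

section Characters

variable {Γ : Type u} [Group Γ]

/-- Positive definite functions on a group: all sums `∑ᵢ ∑ⱼ conj αᵢ * αⱼ * φ (gᵢ⁻¹ gⱼ)` are
(real and) nonnegative. -/
def IsPosDef (φ : Γ → ℂ) : Prop :=
  ∀ (n : ℕ) (g : Fin n → Γ) (α : Fin n → ℂ),
    0 ≤ ∑ i, ∑ j, conj (α i) * α j * φ ((g i)⁻¹ * g j)

variable (Γ) in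
/-- The convex set of all normalized positive definite functions. It is regarded as a subset of
`Γ → ℂ` with the product topology; as it is a norm bounded subset of `ℓ^∞(Γ)`, this induces on it
the weak-* topology. -/
def normalizedPosDef : Set (Γ → ℂ) := {φ | IsPosDef φ ∧ φ 1 = 1}

variable (Γ) in
/-- A character: a normalized, conjugation invariant, positive definite function. -/
structure GroupCharacter where
  toFun : Γ → ℂ
  posDef : IsPosDef toFun
  conj_invariant : ∀ g h : Γ, toFun (h * g * h⁻¹) = toFun g
  normalized : toFun 1 = 1

instance : CoeFun (GroupCharacter Γ) (fun _ => Γ → ℂ) := ⟨GroupCharacter.toFun⟩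

/-- Extremal (indecomposable) characters: those which are not a proper convex combination of two
distinct characters. -/
def GroupCharacter.IsExtremal (φ : GroupCharacter Γ) : Prop :=
  ¬ ∃ (φ₁ φ₂ : GroupCharacter Γ) (a : ℝ), 0 < a ∧ a < 1 ∧ φ₁ ≠ φ₂ ∧
    ∀ g, φ g = (a : ℂ) * φ₁ g + (1 - (a : ℂ)) * φ₂ g

open Classical in
variable (Γ) in
/-- The function `δ_e`, i.e. the regular character. -/
def deltaOne : Γ → ℂ := fun g => if g = 1 then 1 else 0

variable (Γ) in
/-- `Γ` has non-factorizable regular character. -/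
def HasNonFactorizableRegularCharacter : Prop :=
  ∀ φ ψ : GroupCharacter Γ, (∀ s : Γ, s ≠ 1 → φ s * ψ s = 0) →
    (φ : Γ → ℂ) = deltaOne Γ ∨ (ψ : Γ → ℂ) = deltaOne Γ

end Characters

/-! ### Unitary representations -/

/-- Unitary representations of a (discrete) group on a complex (pre-)Hilbert space. -/
abbrev UnitaryRep (Γ : Type u) [Group Γ] (H : Type v) [SeminormedAddCommGroup H]
    [InnerProductSpace ℂ H] := Γ →* (H ≃ₗᵢ[ℂ] H)

section Completion

variable {E : Type v} [SeminormedAddCommGroup E] [InnerProductSpace ℂ E]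

/-- The extension of a surjective linear isometry to the completion. -/
def completionIso (f : E ≃ₗᵢ[ℂ] E) :
    UniformSpace.Completion E ≃ₗᵢ[ℂ] UniformSpace.Completion E where
  toFun := UniformSpace.Completion.map f
  invFun := UniformSpace.Completion.map f.symm
  map_add' x y := by
    have hf : UniformContinuous f := f.isometry.uniformContinuous
    induction x, y using UniformSpace.Completion.induction_on₂ with
    | hp =>
      exact isClosed_eq (UniformSpace.Completion.continuous_map.comp continuous_add)
        (Continuous.add (f := fun p : _ × _ => UniformSpace.Completion.map f p.1)
          (g := fun p => UniformSpace.Completion.map f p.2)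
          (UniformSpace.Completion.continuous_map.comp continuous_fst)
          (UniformSpace.Completion.continuous_map.comp continuous_snd))
    | ih a b =>
      rw [← UniformSpace.Completion.coe_add, UniformSpace.Completion.map_coe hf,
        UniformSpace.Completion.map_coe hf, UniformSpace.Completion.map_coe hf, map_add,
        UniformSpace.Completion.coe_add]
  map_smul' c x := by
    have hf : UniformContinuous f := f.isometry.uniformContinuous
    induction x using UniformSpace.Completion.induction_on with
    | hp =>
      exact isClosed_eq
        (UniformSpace.Completion.continuous_map.comp (continuous_const_smul c))
        ((continuous_const_smul _).comp UniformSpace.Completion.continuous_map)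
    | ih a =>
      rw [← UniformSpace.Completion.coe_smul, UniformSpace.Completion.map_coe hf,
        UniformSpace.Completion.map_coe hf, map_smul, UniformSpace.Completion.coe_smul,
        RingHom.id_apply]
  left_inv x := by
    have hf : UniformContinuous f := f.isometry.uniformContinuous
    have hg : UniformContinuous f.symm := f.symm.isometry.uniformContinuous
    rw [← Function.comp_apply (f := UniformSpace.Completion.map f.symm),
      UniformSpace.Completion.map_comp hg hf]
    simp
  right_inv x := by
    have hf : UniformContinuous f := f.isometry.uniformContinuous
    have hg : UniformContinuous f.symm := f.symm.isometry.uniformContinuous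
    rw [← Function.comp_apply (f := UniformSpace.Completion.map f),
      UniformSpace.Completion.map_comp hf hg]
    simp
  norm_map' x := by
    have hf : UniformContinuous f := f.isometry.uniformContinuous
    change ‖UniformSpace.Completion.map f x‖ = ‖x‖
    induction x using UniformSpace.Completion.induction_on with
    | hp => exact isClosed_eq UniformSpace.Completion.continuous_map.norm continuous_norm
    | ih a =>
      rw [UniformSpace.Completion.map_coe hf, UniformSpace.Completion.norm_coe,
        UniformSpace.Completion.norm_coe, f.norm_map]

theorem completionIso_coe (f : E ≃ₗᵢ[ℂ] E) (x : E) :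
    completionIso f (x : UniformSpace.Completion E) = (f x : E) :=
  UniformSpace.Completion.map_coe f.isometry.uniformContinuous x

/-- The extension of a unitary representation on a pre-Hilbert space to its completion. -/
def completionRep {Γ : Type u} [Group Γ] (π : UnitaryRep Γ E) :
    UnitaryRep Γ (UniformSpace.Completion E) where
  toFun g := completionIso (π g)
  map_one' := by
    ext x
    induction x using UniformSpace.Completion.induction_on with
    | hp => exact isClosed_eq (LinearIsometryEquiv.continuous _) continuous_id
    | ih a => rw [completionIso_coe, map_one]; rfl
  map_mul' g h := by
    ext x
    induction x using UniformSpace.Completion.induction_on with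
    | hp =>
      exact isClosed_eq (LinearIsometryEquiv.continuous _)
        (LinearIsometryEquiv.continuous _)
    | ih a =>
      change _ = completionIso (π g) (completionIso (π h) _)
      rw [completionIso_coe, completionIso_coe, completionIso_coe, map_mul]
      rfl

end Completion

section ConjugateSpace

/-- The complex conjugate Hilbert space: the same additive group, with scalar multiplication
`c • x := conj c • x` and inner product `⟪x, y⟫ := ⟪y, x⟫`. -/
def ConjSpace (H : Type v) : Type v := H

variable {H : Type v} [NormedAddCommGroup H] [InnerProductSpace ℂ H]

instance : NormedAddCommGroup (ConjSpace H) := inferInstanceAs (NormedAddCommGroup H)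

instance : Module ℂ (ConjSpace H) := Module.compHom H (starRingEnd ℂ)

theorem ConjSpace.smul_def (c : ℂ) (x : ConjSpace H) :
    c • x = (show ConjSpace H from (conj c • (show H from x) : H)) := rfl

instance : InnerProductSpace ℂ (ConjSpace H) where
  norm_smul_le c x := by
    have h := norm_smul_le (conj c) (show H from x)
    rw [RCLike.norm_conj] at h
    exact h
  inner x y := inner ℂ (show H from y) (show H from x)
  norm_sq_eq_re_inner x := norm_sq_eq_re_inner (𝕜 := ℂ) (show H from x)
  conj_inner_symm x y := inner_conj_symm (𝕜 := ℂ) (show H from y) (show H from x)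
  add_left x y z := inner_add_right (𝕜 := ℂ) (show H from z) (show H from x) (show H from y)
  smul_left x y r :=
    inner_smul_right (𝕜 := ℂ) (show H from y) (show H from x) (conj r)

/-- A unitary operator, regarded as a unitary operator of the conjugate Hilbert space. -/
def conjIso (f : H ≃ₗᵢ[ℂ] H) : ConjSpace H ≃ₗᵢ[ℂ] ConjSpace H where
  toFun x := f (show H from x)
  invFun x := f.symm (show H from x)
  map_add' x y := f.map_add (show H from x) (show H from y)
  map_smul' c x := f.map_smul (conj c) (show H from x)
  left_inv x := f.symm_apply_apply (show H from x)
  right_inv x := f.apply_symm_apply (show H from x)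
  norm_map' x := f.norm_map (show H from x)

/-- The conjugate representation. -/
def conjRep {Γ : Type u} [Group Γ] (π : UnitaryRep Γ H) : UnitaryRep Γ (ConjSpace H) where
  toFun g := conjIso (π g)
  map_one' := by ext x; change π 1 (show H from x) = x; rw [map_one]; rfl
  map_mul' g h := by
    ext x
    change π (g * h) (show H from x) = π g (π h (show H from x))
    rw [map_mul]; rfl

end ConjugateSpace

section Representations

variable {Γ : Type u} [Group Γ]

/-- The tensor product of two unitary representations on the algebraic tensor product. -/
def algTensorRep {H : Type v} [NormedAddCommGroup H] [InnerProductSpace ℂ H]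
    {K : Type w} [NormedAddCommGroup K] [InnerProductSpace ℂ K]
    (π : UnitaryRep Γ H) (ρ : UnitaryRep Γ K) : UnitaryRep Γ (H ⊗[ℂ] K) where
  toFun g := TensorProduct.congrIsometry (π g) (ρ g)
  map_one' := by
    rw [map_one, map_one]
    exact TensorProduct.congrIsometry_refl_refl
  map_mul' g h := by
    ext x
    change _ = TensorProduct.congrIsometry (π g) (ρ g) (TensorProduct.congrIsometry (π h) (ρ h) x)
    induction x with
    | zero => simp only [map_zero]
    | tmul a b => rw [map_mul, map_mul]; rfl
    | add x y hx hy => simp only [map_add, hx, hy]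

/-- The tensor product of two unitary representations, on the Hilbert space tensor product. -/
def tensorRep {H : Type v} [NormedAddCommGroup H] [InnerProductSpace ℂ H]
    {K : Type w} [NormedAddCommGroup K] [InnerProductSpace ℂ K]
    (π : UnitaryRep Γ H) (ρ : UnitaryRep Γ K) :
    UnitaryRep Γ (UniformSpace.Completion (H ⊗[ℂ] K)) :=
  completionRep (algTensorRep π ρ)

/-- Weak containment `π ≺ ρ`: every diagonal coefficient of `π` is approximated, uniformly on
finite subsets of `Γ`, by finite sums of diagonal coefficients of `ρ`. -/
def WeaklyContained {H : Type v} [NormedAddCommGroup H] [InnerProductSpace ℂ H]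
    {K : Type w} [NormedAddCommGroup K] [InnerProductSpace ℂ K]
    (π : UnitaryRep Γ H) (ρ : UnitaryRep Γ K) : Prop :=
  ∀ (ξ : H) (F : Finset Γ) (ε : ℝ), 0 < ε → ∃ (n : ℕ) (η : Fin n → K),
    ∀ g ∈ F, ‖inner ℂ ξ (π g ξ) - ∑ i, inner ℂ (η i) (ρ g (η i))‖ < ε

/-- Amenability of a unitary representation in the sense of Bekka: the trivial representation is
weakly contained in `π ⊗ π̄`. -/
def UnitaryRep.IsAmenable {H : Type v} [NormedAddCommGroup H] [InnerProductSpace ℂ H]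
    (π : UnitaryRep Γ H) : Prop :=
  WeaklyContained (1 : UnitaryRep Γ ℂ) (tensorRep π (conjRep π))

/-- Unitary equivalence of unitary representations. -/
def UnitarilyEquivalent {H : Type v} [SeminormedAddCommGroup H] [InnerProductSpace ℂ H]
    {K : Type w} [SeminormedAddCommGroup K] [InnerProductSpace ℂ K]
    (π : UnitaryRep Γ H) (ρ : UnitaryRep Γ K) : Prop :=
  ∃ U : H ≃ₗᵢ[ℂ] K, ∀ (g : Γ) (x : H), U (π g x) = ρ g (U x)

variable (Γ) in
/-- Unitary equivalence on the `n`-dimensional unitary representations. -/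
def unitaryRepSetoid (n : ℕ) : Setoid (UnitaryRep Γ (EuclideanSpace ℂ (Fin n))) where
  r := UnitarilyEquivalent
  iseqv :=
    { refl := fun _ => ⟨LinearIsometryEquiv.refl ℂ _, fun _ _ => rfl⟩
      symm := fun {π ρ} ⟨U, hU⟩ => ⟨U.symm, fun g x => by
        rw [LinearIsometryEquiv.symm_apply_eq, hU, U.apply_symm_apply]⟩
      trans := fun {π ρ σ} ⟨U, hU⟩ ⟨V, hV⟩ => ⟨U.trans V, fun g x => by
        rw [LinearIsometryEquiv.trans_apply, LinearIsometryEquiv.trans_apply, hU, hV]⟩ }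

end Representations

/-! ### Von Neumann algebras -/

section VonNeumann

variable {H : Type v} [NormedAddCommGroup H] [InnerProductSpace ℂ H] [CompleteSpace H]

/-- The von Neumann algebra `(S ∪ S*)''` generated by a set `S` of bounded operators. -/
def generatedVN (S : Set (H →L[ℂ] H)) : VonNeumannAlgebra H where
  toStarSubalgebra := StarSubalgebra.centralizer ℂ
    ((StarSubalgebra.centralizer ℂ S : StarSubalgebra ℂ (H →L[ℂ] H)) : Set (H →L[ℂ] H))
  centralizer_centralizer' := Set.centralizer_centralizer_centralizer _

/-- The von Neumann algebra `π(Γ)''` generated by the image of a unitary representation. -/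
def UnitaryRep.vonNeumannAlgebra {Γ : Type u} [Group Γ] (π : UnitaryRep Γ H) :
    VonNeumannAlgebra H :=
  generatedVN (Set.range fun g => ((π g).toContinuousLinearEquiv : H →L[ℂ] H))

/-- Amenability (injectivity) of a von Neumann algebra `M` acting on `H`: there is a conditional
expectation from `B(H)` onto `M`. -/
def IsAmenableVN (M : VonNeumannAlgebra H) : Prop :=
  ∃ E : (H →L[ℂ] H) →ₗ[ℂ] (H →L[ℂ] H),
    (∀ x, E x ∈ M) ∧ (∀ x ∈ M, E x = x) ∧
    (∀ x : H →L[ℂ] H, x.IsPositive → (E x).IsPositive) ∧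
    (∀ a ∈ M, ∀ b ∈ M, ∀ x, E (a * x * b) = a * E x * b)

end VonNeumann

/-! ### The GNS representation of a positive definite function -/

section GNS

variable {Γ : Type u} [Group Γ]

/-- The space of finitely supported functions on `Γ`, to be endowed with the sesquilinear form
given by a positive definite function `φ`. -/
def PreGNS (φ : Γ → ℂ) (_hφ : IsPosDef φ) : Type u := Γ →₀ ℂ

variable (φ : Γ → ℂ) (hφ : IsPosDef φ)

instance : AddCommGroup (PreGNS φ hφ) := inferInstanceAs (AddCommGroup (Γ →₀ ℂ))
instance : Module ℂ (PreGNS φ hφ) := inferInstanceAs (Module ℂ (Γ →₀ ℂ))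

/-- The sesquilinear form with `⟪δ_g, δ_h⟫ = φ (g⁻¹ h)`. -/
def gnsForm (x y : Γ →₀ ℂ) : ℂ :=
  x.sum fun g a => y.sum fun h b => conj a * b * φ (g⁻¹ * h)

variable {φ}

theorem IsPosDef.map_inv (hφ : IsPosDef φ) (g : Γ) : φ g⁻¹ = conj (φ g) := by
  have h1 := hφ 1 ![1] ![1]
  have h2 := hφ 2 ![1, g] ![1, 1]
  have h3 := hφ 2 ![1, g] ![1, Complex.I]
  simp only [Complex.le_def] at h1 h2 h3
  simp [Fin.sum_univ_two] at h1 h2 h3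
  apply Complex.ext
  · simp; linarith [h1.2, h2.2, h3.2]
  · simp; linarith [h1.2, h2.2, h3.2]

theorem gnsForm_self_nonneg (hφ : IsPosDef φ) (x : Γ →₀ ℂ) : 0 ≤ gnsForm φ x x := by
  have h := hφ x.support.card (fun i => (x.support.equivFin.symm i : Γ))
    (fun i => x (x.support.equivFin.symm i : Γ))
  have key : gnsForm φ x x = ∑ i : Fin x.support.card, ∑ j : Fin x.support.card,
      conj (x (x.support.equivFin.symm i : Γ)) * x (x.support.equivFin.symm j : Γ) *
        φ ((x.support.equivFin.symm i : Γ)⁻¹ * (x.support.equivFin.symm j : Γ)) := by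
    rw [gnsForm, Finsupp.sum, ← Finset.sum_coe_sort,
      ← Equiv.sum_comp x.support.equivFin.symm]
    refine Finset.sum_congr rfl fun i _ => ?_
    rw [Finsupp.sum, ← Finset.sum_coe_sort, ← Equiv.sum_comp x.support.equivFin.symm]
  rw [key]
  exact h

variable (φ)

theorem gnsForm_add_left (x y z : Γ →₀ ℂ) :
    gnsForm φ (x + y) z = gnsForm φ x z + gnsForm φ y z := by
  refine Finsupp.sum_add_index' (fun g => ?_) (fun g a b => ?_)
  · simp [Finsupp.sum]
  · simp [Finsupp.sum, add_mul, Finset.sum_add_distrib]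

theorem gnsForm_smul_left (x y : Γ →₀ ℂ) (r : ℂ) :
    gnsForm φ (r • x) y = conj r * gnsForm φ x y := by
  unfold gnsForm
  rw [Finsupp.sum_smul_index (fun g => by simp [Finsupp.sum]), Finsupp.mul_sum]
  refine Finsupp.sum_congr fun g _ => ?_
  rw [Finsupp.mul_sum]
  exact Finsupp.sum_congr fun h _ => by rw [map_mul]; ring

theorem gnsForm_translate (x y : Γ →₀ ℂ) (g : Γ) :
    gnsForm φ (Finsupp.domLCongr (R := ℂ) (Equiv.mulLeft g) x)
      (Finsupp.domLCongr (R := ℂ) (Equiv.mulLeft g) y) = gnsForm φ x y := by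
  simp only [gnsForm, Finsupp.domLCongr_apply, Finsupp.domCongr_apply,
    Finsupp.sum_equivMapDomain, Equiv.coe_mulLeft, mul_inv_rev, mul_assoc, inv_mul_cancel_left]

/-- The positive semidefinite inner product on finitely supported functions. -/
instance gnsCore : PreInnerProductSpace.Core ℂ (PreGNS φ hφ) where
  inner x y := gnsForm φ x y
  conj_inner_symm x y := by
    change conj (gnsForm φ y x) = gnsForm φ x y
    simp only [gnsForm, Finsupp.sum, map_sum, map_mul, Complex.conj_conj, ← hφ.map_inv,
      mul_inv_rev, inv_inv]
    rw [Finset.sum_comm]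
    exact Finset.sum_congr rfl fun i _ => Finset.sum_congr rfl fun j _ => by ring
  re_inner_nonneg x := (Complex.le_def.1 (gnsForm_self_nonneg hφ x)).1
  add_left x y z := gnsForm_add_left φ x y z
  smul_left x y r := gnsForm_smul_left φ x y r

instance : SeminormedAddCommGroup (PreGNS φ hφ) :=
  InnerProductSpace.Core.toSeminormedAddCommGroup (𝕜 := ℂ) (F := PreGNS φ hφ)

instance : InnerProductSpace ℂ (PreGNS φ hφ) := InnerProductSpace.ofCore (gnsCore φ hφ)

/-- Left translation by `g`, mapping `δ_h` to `δ_{g h}`. -/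
def gnsTranslation (g : Γ) : PreGNS φ hφ ≃ₗᵢ[ℂ] PreGNS φ hφ :=
  LinearEquiv.isometryOfInner
    (show PreGNS φ hφ ≃ₗ[ℂ] PreGNS φ hφ from
      (Finsupp.domLCongr (Equiv.mulLeft g) : (Γ →₀ ℂ) ≃ₗ[ℂ] (Γ →₀ ℂ)))
    (fun x y => gnsForm_translate φ x y g)

theorem domLCongr_mulLeft_one (x : Γ →₀ ℂ) :
    Finsupp.domLCongr (R := ℂ) (Equiv.mulLeft (1 : Γ)) x = x := by
  ext k
  simp only [Finsupp.domLCongr_apply, Finsupp.domCongr_apply, Finsupp.equivMapDomain_apply,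
    Equiv.mulLeft_symm, Equiv.coe_mulLeft, inv_one, one_mul]

theorem domLCongr_mulLeft_mul (g h : Γ) (x : Γ →₀ ℂ) :
    Finsupp.domLCongr (R := ℂ) (Equiv.mulLeft (g * h)) x =
      Finsupp.domLCongr (R := ℂ) (Equiv.mulLeft g)
        (Finsupp.domLCongr (R := ℂ) (Equiv.mulLeft h) x) := by
  ext k
  simp only [Finsupp.domLCongr_apply, Finsupp.domCongr_apply, Finsupp.equivMapDomain_apply,
    Equiv.mulLeft_symm, Equiv.coe_mulLeft, mul_inv_rev, mul_assoc]

/-- The left translation representation on finitely supported functions. -/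
def preGnsRep : UnitaryRep Γ (PreGNS φ hφ) where
  toFun g := gnsTranslation φ hφ g
  map_one' := LinearIsometryEquiv.ext fun x => domLCongr_mulLeft_one x
  map_mul' g h := LinearIsometryEquiv.ext fun x => domLCongr_mulLeft_mul g h x

/-- The GNS Hilbert space: the (Hausdorff) completion. -/
abbrev GNSSpace : Type u := UniformSpace.Completion (PreGNS φ hφ)

/-- The GNS representation. -/
def gnsRep : UnitaryRep Γ (GNSSpace φ hφ) := completionRep (preGnsRep φ hφ)

end GNS

/-! ### Amenability and charfinite groups -/

section Groups

/-- Amenability of a discrete group: existence of a left invariant finitely additive probability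
measure on all subsets. -/
def IsAmenableGroup (G : Type u) [Group G] : Prop :=
  ∃ m : Set G → ℝ, (∀ A, 0 ≤ m A) ∧ m Set.univ = 1 ∧
    (∀ A B, Disjoint A B → m (A ∪ B) = m A + m B) ∧
    ∀ (g : G) (A : Set G), m ((fun x => g * x) '' A) = m A

variable (Γ : Type u) [Group Γ]

/-- The amenable radical: the subgroup generated by all amenable normal subgroups, i.e. the
largest amenable normal subgroup. -/
def amenableRadical : Subgroup Γ := sSup {N | N.Normal ∧ IsAmenableGroup N}

variable {Γ}

/-- A character is amenable if its GNS representation is. -/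
def GroupCharacter.IsAmenable (φ : GroupCharacter Γ) : Prop :=
  UnitaryRep.IsAmenable (gnsRep φ.toFun φ.posDef)

/-- A character is von Neumann amenable if it is amenable and its GNS representation generates an
amenable von Neumann algebra. -/
def GroupCharacter.IsVonNeumannAmenable (φ : GroupCharacter Γ) : Prop :=
  φ.IsAmenable ∧ IsAmenableVN (UnitaryRep.vonNeumannAlgebra (gnsRep φ.toFun φ.posDef))

/-- A character is finite if its GNS representation is finite dimensional. -/
def GroupCharacter.IsFinite (φ : GroupCharacter Γ) : Prop :=
  FiniteDimensional ℂ (GNSSpace φ.toFun φ.posDef)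

variable (Γ)

/-- Charfinite groups. -/
structure IsCharfinite : Prop where
  countable : Countable Γ
  /-- Every non-empty compact convex conjugation invariant set of normalized positive definite
  functions contains a fixed point. -/
  exists_fixed : ∀ C : Set (Γ → ℂ), C ⊆ normalizedPosDef Γ → C.Nonempty → IsCompact C →
    Convex ℝ C → (∀ (h : Γ), ∀ φ ∈ C, (fun g => φ (h⁻¹ * g * h)) ∈ C) →
    ∃ φ ∈ C, ∀ h : Γ, (fun g => φ (h⁻¹ * g * h)) = φ
  supported_or_amenable : ∀ φ : GroupCharacter Γ, φ.IsExtremal →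
    (∀ g, g ∉ amenableRadical Γ → φ g = 0) ∨ φ.IsVonNeumannAmenable
  radical_finite : Finite (amenableRadical Γ)
  /-- For each `n` there are finitely many isomorphism classes of `n`-dimensional unitary
  representations. -/
  finite_classes : ∀ n : ℕ, Finite (Quotient (unitaryRepSetoid Γ n))
  amenable_finite : ∀ φ : GroupCharacter Γ, φ.IsExtremal → φ.IsAmenable → φ.IsFinite

variable {Γ}

/-! ### Distorted elements -/

/-- The word length of `g` with respect to `S`: the least length of a word in `S ∪ S⁻¹`
representing `g`. -/
def wordLength (S : Set Γ) (g : Γ) : ℕ :=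
  sInf {n | ∃ l : List Γ, (∀ x ∈ l, x ∈ S ∨ x⁻¹ ∈ S) ∧ l.prod = g ∧ l.length = n}

/-- The translation number `liminf ℓ_S(γⁿ) / n`. -/
def translationNumber (S : Set Γ) (γ : Γ) : ℝ :=
  Filter.liminf (fun n : ℕ => (wordLength S (γ ^ n) : ℝ) / (n : ℝ)) Filter.atTop

/-- `γ` is distorted: its translation number with respect to a finite generating set vanishes. -/
def IsDistorted (γ : Γ) : Prop :=
  ∃ S : Finset Γ, Subgroup.closure (S : Set Γ) = ⊤ ∧ translationNumber (S : Set Γ) γ = 0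

end Groups

end NFRC

end

namespace NFRC

open Cardinal Polynomial

/-! ### Extending embeddings to algebraically closed fields -/

/-! Evaluate characters along γ^(k!). With trivial radical, conditions 2 and 5 make every extremal
character either δ_e or finite (`IsCharfinite.eq_deltaOne_or_isFinite`). By Choquet's theorem a
character φ is the barycentre of a probability measure μ carried by extremal characters
(`GroupCharacter.exists_measure_isExtremal`). A finite character equals 1 at γ^(k!) for all large k,
while δ_e vanishes there, so dominated convergence gives φ(γ^(k!)) → μ({χ ≠ δ_e}), which is nonzero
unless φ = δ_e. If neither φ nor ψ were δ_e, then φψ would have a nonzero limit along γ^(k!) ≠ e,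
although it vanishes there.

The remaining point is that γ has finite order in every finite-dimensional unitary representation
(`IsDistorted.exists_pow_map_eq_one`). Let z be an eigenvalue of γ. An embedding σ of the scalars
into a normed field turns the representation into matrices over that field, so ‖σ z‖^n is at most
exponential in the word length of γ^n; distortion forces ‖σ z‖ ≤ 1. With targets ℂ and the algebraic
closures of all ℚ_p, z has to be an algebraic integer with all conjugates in the unit disc, hence a
root of unity by Kronecker. Unitarity makes γ diagonalizable, so a common exponent kills it.

Steinitz's argument: as R is countable and the fields are uncountable, transcendence bases over R
have the cardinality of the fields. Matching bases identifies two polynomial subrings, and hence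
their algebraic closures K and L. -/

theorem exists_ringHom_comp_eq {R K L : Type} [CommRing R] [Countable R] [Field K] [Field L]
    [IsAlgClosed K] [IsAlgClosed L] (hK : ℵ₀ < #K) (hKL : #K = #L)
    (f : R →+* K) (g : R →+* L) (hf : Function.Injective f) (hg : Function.Injective g) :
    ∃ σ : K →+* L, ∀ r, σ (f r) = g r := by
  let : Algebra R K := f.toAlgebra
  let : Algebra R L := g.toAlgebra
  have : FaithfulSMul R K := (faithfulSMul_iff_algebraMap_injective R K).mpr hf
  have : FaithfulSMul R L := (faithfulSMul_iff_algebraMap_injective R L).mpr hg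
  have : Nontrivial R := f.domain_nontrivial
  obtain ⟨s, hs⟩ := exists_isTranscendenceBasis R K
  obtain ⟨t, ht⟩ := exists_isTranscendenceBasis R L
  have hst : #s = #t := by
    rw [← IsAlgClosed.cardinal_eq_cardinal_transcendence_basis_of_aleph0_lt' _ hs
      mk_le_aleph0 hK, hKL, IsAlgClosed.cardinal_eq_cardinal_transcendence_basis_of_aleph0_lt' _ ht
      mk_le_aleph0 (hKL ▸ hK)]
  obtain ⟨e⟩ := Cardinal.eq.1 hst
  let := IsAlgClosed.isAlgClosure_of_transcendence_basis _ hs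
  let := IsAlgClosed.isAlgClosure_of_transcendence_basis _ ht
  let E : Algebra.adjoin R (Set.range ((↑) : s → K)) ≃ₐ[R]
      Algebra.adjoin R (Set.range ((↑) : t → L)) :=
    (hs.1.aevalEquiv.symm.trans (MvPolynomial.renameEquiv R e)).trans ht.1.aevalEquiv
  refine ⟨(IsAlgClosure.equivOfEquiv K L E.toRingEquiv : K ≃+* L), fun r => ?_⟩
  have h := IsAlgClosure.equivOfEquiv_algebraMap K L E.toRingEquiv (algebraMap R _ r)
  have h2 : E.toRingEquiv (algebraMap R _ r) = algebraMap R _ r := E.commutes r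
  rw [h2] at h
  exact h

theorem mk_padicAlgCl (p : ℕ) [Fact p.Prime] : #(PadicAlgCl p) = 𝔠 := by
  have h1 : #ℚ_[p] ≤ 𝔠 := by
    refine (mk_quotient_le (α := CauSeq ℚ (padicNorm p))).trans ?_
    refine (mk_subtype_le _).trans ?_
    simp
  have h2 : 𝔠 ≤ #ℚ_[p] := continuum_le_cardinal_of_nontriviallyNormedField _
  apply le_antisymm
  · refine (Algebra.IsAlgebraic.cardinalMk_le_max ℚ_[p] (PadicAlgCl p)).trans ?_
    exact max_le h1 aleph0_le_continuum
  · exact h2.trans (mk_le_of_injective (algebraMap ℚ_[p] (PadicAlgCl p)).injective)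

/-- Send z to w on the countable field ℚ(z), then extend to ℂ. Thus every root of the minimal
polynomial in L is an image of z, and bounds on all images become bounds on all roots. -/
theorem exists_ringHom_apply_eq_of_aeval_minpoly {L : Type} [Field L] [CharZero L] [IsAlgClosed L]
    (hL : #L = 𝔠) {z : ℂ} (hz : IsIntegral ℚ z) {w : L}
    (hw : aeval w (minpoly ℚ z) = 0) : ∃ σ : ℂ →+* L, σ z = w := by
  have : Countable (IntermediateField.adjoin ℚ {z}) := by
    have := IntermediateField.adjoin.finiteDimensional hz
    have := Algebra.IsAlgebraic.cardinalMk_le_max ℚ (IntermediateField.adjoin ℚ {z})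
    rw [← Cardinal.mk_le_aleph0_iff]
    simpa using this
  let g : IntermediateField.adjoin ℚ {z} →ₐ[ℚ] L :=
    (IntermediateField.algHomAdjoinIntegralEquiv ℚ hz).symm
      ⟨w, by rw [mem_aroots]; exact ⟨minpoly.ne_zero hz, hw⟩⟩
  obtain ⟨σ, hσ⟩ := exists_ringHom_comp_eq (K := ℂ) (L := L)
    (by rw [mk_complex]; exact aleph0_lt_continuum)
    (by rw [mk_complex, hL]) (algebraMap (IntermediateField.adjoin ℚ {z}) ℂ) g.toRingHom
    (FaithfulSMul.algebraMap_injective _ _) g.toRingHom.injective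
  refine ⟨σ, ?_⟩
  have := hσ (IntermediateField.AdjoinSimple.gen ℚ z)
  rw [IntermediateField.AdjoinSimple.algebraMap_gen] at this
  rw [this]
  exact IntermediateField.algHomAdjoinIntegralEquiv_symm_apply_gen ℚ hz _

theorem exists_ringHom_apply_eq_of_transcendental {z w : ℂ} (hz : Transcendental ℚ z)
    (hw : Transcendental ℚ w) : ∃ σ : ℂ →+* ℂ, σ z = w := by
  have : Countable ℚ[X] := by
    rw [← Cardinal.mk_le_aleph0_iff]
    exact Polynomial.cardinalMk_le_max.trans (by simp)
  obtain ⟨σ, hσ⟩ := exists_ringHom_comp_eq (R := ℚ[X]) (K := ℂ) (L := ℂ)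
    (by rw [mk_complex]; exact aleph0_lt_continuum) rfl (aeval z).toRingHom (aeval w).toRingHom
    (transcendental_iff_injective.1 hz) (transcendental_iff_injective.1 hw)
  refine ⟨σ, ?_⟩
  simpa using hσ X

/-! ### A criterion for roots of unity -/

/-- In an ultrametric field the closed unit ball is a subring, and P is a product of factors X - w
with w in it. -/
theorem norm_coeff_le_one_of_splits {L : Type*} [NormedField L] [IsUltrametricDist L] {P : L[X]}
    (hP : P.Splits) (hm : P.Monic) (h : ∀ w ∈ P.roots, ‖w‖ ≤ 1) (n : ℕ) : ‖P.coeff n‖ ≤ 1 := by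
  let O : Subring L :=
    { carrier := {x | ‖x‖ ≤ 1}
      mul_mem' := fun {a b} ha hb => by
        change ‖a * b‖ ≤ 1
        rw [norm_mul]; exact mul_le_one₀ ha (norm_nonneg _) hb
      one_mem' := by simp
      add_mem' := fun {a b} ha hb => (IsUltrametricDist.norm_add_le_max a b).trans (max_le ha hb)
      zero_mem' := by simp
      neg_mem' := fun {a} ha => by simpa using ha }
  have : P ∈ lifts O.subtype := by
    rw [hP.eq_prod_roots_of_monic hm]
    refine Subsemiring.multiset_prod_mem _ _ fun q hq => ?_
    obtain ⟨w, hw, rfl⟩ := Multiset.mem_map.1 hq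
    refine (liftsRing O.subtype).sub_mem (X_mem_lifts _) ?_
    exact C_mem_lifts O.subtype ⟨w, h w hw⟩
  obtain ⟨x, hx⟩ := (lifts_iff_coeff_lifts _).1 this n
  rw [← hx]
  exact x.2

/-- A prime p in the denominator of a coefficient of the minimal polynomial would give that
coefficient p-adic norm above 1, although all roots over `PadicAlgCl p` have norm at most 1. -/
theorem isIntegral_of_forall_norm_le_one {z : ℂ} (hz : IsIntegral ℚ z)
    (h : ∀ (p : ℕ) [Fact p.Prime] (σ : ℂ →+* PadicAlgCl p), ‖σ z‖ ≤ 1) : IsIntegral ℤ z := by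
  have key : ∀ n, (minpoly ℚ z).coeff n ∈ Set.range (Int.castRingHom ℚ) := by
    intro n
    set q := (minpoly ℚ z).coeff n with hq
    suffices hden : q.den = 1 from ⟨q.num, by simpa using Rat.coe_int_num_of_den_eq_one hden⟩
    by_contra hden
    obtain ⟨p, hp, hpd⟩ := Nat.exists_prime_and_dvd hden
    have : Fact p.Prime := ⟨hp⟩
    have h1 : ‖((minpoly ℚ z).map (algebraMap ℚ (PadicAlgCl p))).coeff n‖ ≤ 1 := by
      refine norm_coeff_le_one_of_splits (IsAlgClosed.splits _)
        ((minpoly.monic hz).map _) (fun w hw => ?_) n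
      rw [mem_roots', IsRoot.def, eval_map_algebraMap] at hw
      obtain ⟨σ, rfl⟩ := exists_ringHom_apply_eq_of_aeval_minpoly (mk_padicAlgCl p) hz hw.2
      exact h p σ
    rw [coeff_map, ← hq] at h1
    have h2 : ‖(q : ℚ_[p])‖ ≤ 1 := by
      rw [← PadicAlgCl.norm_extends]
      simpa using h1
    rw [Padic.eq_padicNorm] at h2
    have h3 : padicNorm p q = padicNorm p q.num / padicNorm p q.den := by
      conv_lhs => rw [← Rat.num_div_den q]
      rw [padicNorm.div]
    have h4 : padicNorm p q.den < 1 := (padicNorm.nat_lt_one_iff _).2 hpd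
    have h5 : padicNorm p q.num = 1 := by
      rw [padicNorm.int_eq_one_iff]
      intro hd
      have := Nat.dvd_gcd (Int.natCast_dvd.1 hd) hpd
      rw [q.reduced] at this
      exact hp.one_lt.ne' (Nat.dvd_one.1 this)
    have h6 : 0 < padicNorm p q.den :=
      lt_of_le_of_ne (padicNorm.nonneg _) (Ne.symm (padicNorm.nonzero (by exact_mod_cast q.den_nz)))
    have h7 : padicNorm p q ≤ 1 := by exact_mod_cast h2
    rw [h3, h5, div_le_one h6] at h7
    linarith
  obtain ⟨Q, hQ, -, hQm⟩ := lifts_and_degree_eq_and_monic ((lifts_iff_coeff_lifts _).2 key)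
    (minpoly.monic hz)
  refine ⟨Q, hQm, ?_⟩
  have := minpoly.aeval ℚ z
  rw [← hQ, aeval_def, eval₂_map] at this
  rwa [Subsingleton.elim ((algebraMap ℚ ℂ).comp (Int.castRingHom ℚ)) (algebraMap ℤ ℂ)] at this

/-- A nonzero complex number all of whose images in `ℂ` and in the algebraic closures of the
`p`-adic fields have absolute value at most one is a root of unity. -/
theorem exists_pow_eq_one_of_forall_norm_le_one {z : ℂ} (hz : z ≠ 0)
    (h : ∀ σ : ℂ →+* ℂ, ‖σ z‖ ≤ 1)
    (hp : ∀ (p : ℕ) [Fact p.Prime] (σ : ℂ →+* PadicAlgCl p), ‖σ z‖ ≤ 1) :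
    ∃ n : ℕ, 0 < n ∧ z ^ n = 1 := by
  by_cases ht : Transcendental ℚ z
  · exfalso
    -- Some embedding sends z to z + 3, but two points of the unit disc are at distance at most 2.
    have ht' : Transcendental ℚ (z + 3) := fun h3 => ht <| by
      have := h3.sub (isAlgebraic_algebraMap (3 : ℚ) (A := ℂ))
      simpa using this
    obtain ⟨σ, hσ⟩ := exists_ringHom_apply_eq_of_transcendental ht ht'
    have h1 := h σ
    have h2 := h (RingHom.id ℂ)
    rw [hσ] at h1
    have h3 : ‖(3 : ℂ)‖ ≤ ‖z + 3‖ + ‖z‖ := by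
      simpa using norm_sub_le (z + 3) z
    simp at h2 h3
    linarith
  · have hi : IsIntegral ℚ z := (not_not.1 ht : IsAlgebraic ℚ z).isIntegral
    have hZ := isIntegral_of_forall_norm_le_one hi hp
    have := IntermediateField.adjoin.finiteDimensional hi
    have : NumberField (IntermediateField.adjoin ℚ {z}) := { }
    obtain ⟨n, hn, h1⟩ := NumberField.Embeddings.pow_eq_one_of_norm_le_one
      (IntermediateField.adjoin ℚ {z}) ℂ (x := IntermediateField.AdjoinSimple.gen ℚ z)
      (fun h0 => hz (by simpa using congrArg (algebraMap _ ℂ) h0))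
      (by
        rw [← isIntegral_algebraMap_iff (FaithfulSMul.algebraMap_injective _ ℂ),
          IntermediateField.AdjoinSimple.algebraMap_gen]
        exact hZ)
      (fun φ => by
        obtain ⟨σ, hσ⟩ := exists_ringHom_apply_eq_of_aeval_minpoly mk_complex hi
          (w := φ (IntermediateField.AdjoinSimple.gen ℚ z)) (by
            have h0 := congrArg φ (IntermediateField.aeval_gen_minpoly ℚ z)
            rw [aeval_def, hom_eval₂, map_zero] at h0
            rwa [aeval_def, Subsingleton.elim (algebraMap ℚ ℂ) (φ.comp (algebraMap ℚ _))])
        rw [← hσ]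
        exact h σ)
    refine ⟨n, hn, ?_⟩
    simpa using congrArg (algebraMap _ ℂ) h1

end NFRC

namespace NFRC

/-! ### Distorted elements in linear representations -/

section Distortion

variable {Γ : Type*} [Group Γ]

/-- Generation makes the set of lengths nonempty, so the `sInf` is attained rather than being the
default 0. -/
theorem exists_list_length_eq_wordLength {S : Set Γ} (hS : Subgroup.closure S = ⊤) (g : Γ) :
    ∃ l : List Γ, (∀ x ∈ l, x ∈ S ∨ x⁻¹ ∈ S) ∧ l.prod = g ∧ l.length = wordLength S g := by
  refine Nat.sInf_mem (s := {n | ∃ l : List Γ, (∀ x ∈ l, x ∈ S ∨ x⁻¹ ∈ S) ∧ l.prod = g ∧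
    l.length = n}) ?_
  have hg : g ∈ (Subgroup.closure S).toSubmonoid := by rw [hS]; exact Subgroup.mem_top g
  rw [Subgroup.closure_toSubmonoid] at hg
  obtain ⟨l, hl, hg⟩ := Submonoid.exists_list_of_mem_closure hg
  exact ⟨l.length, l, hl, hg, rfl⟩

theorem wordLength_pow_le {S : Set Γ} (hS : Subgroup.closure S = ⊤) (g : Γ) (n : ℕ) :
    wordLength S (g ^ n) ≤ n * wordLength S g := by
  obtain ⟨l, hl, hg, hlen⟩ := exists_list_length_eq_wordLength hS g
  refine Nat.sInf_le ⟨(List.replicate n l).flatten, fun x hx => ?_, ?_, ?_⟩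
  · obtain ⟨m, hm, hxm⟩ := List.mem_flatten.1 hx
    rw [List.eq_of_mem_replicate hm] at hxm
    exact hl x hxm
  · simp [List.prod_flatten, hg]
  · simp [hlen]

theorem exists_norm_le_pow_wordLength {S : Finset Γ} (hS : Subgroup.closure (S : Set Γ) = ⊤)
    {A : Type*} [SeminormedRing A] (ρ : Γ →* A) :
    ∃ C : ℝ, 1 < C ∧ ∀ g, ‖ρ g‖ ≤ C ^ wordLength (S : Set Γ) g * ‖(1 : A)‖ := by
  -- The sum dominates every generator and its inverse; the summand 2 makes log C positive later.
  set C : ℝ := 2 + ∑ s ∈ S, (‖ρ s‖ + ‖ρ s⁻¹‖) with hC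
  have hsum : 0 ≤ ∑ s ∈ S, (‖ρ s‖ + ‖ρ s⁻¹‖) := Finset.sum_nonneg fun _ _ => by positivity
  have hle : ∀ s ∈ S, ‖ρ s‖ + ‖ρ s⁻¹‖ ≤ C := fun s hs => by
    have := Finset.single_le_sum (f := fun s => ‖ρ s‖ + ‖ρ s⁻¹‖)
      (fun _ _ => by positivity) hs
    linarith
  have hgen : ∀ x : Γ, x ∈ (S : Set Γ) ∨ x⁻¹ ∈ (S : Set Γ) → ‖ρ x‖ ≤ C := by
    rintro x (hx | hx)
    · linarith [hle x hx, norm_nonneg (ρ x⁻¹)]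
    · have := hle _ hx
      rw [inv_inv] at this
      linarith [norm_nonneg (ρ x⁻¹)]
  have hlist : ∀ l : List Γ, (∀ x ∈ l, x ∈ (S : Set Γ) ∨ x⁻¹ ∈ (S : Set Γ)) →
      ‖ρ l.prod‖ ≤ C ^ l.length * ‖(1 : A)‖ := by
    intro l
    induction l with
    | nil => simp
    | cons x l ih =>
      intro h
      rw [List.prod_cons, map_mul, List.length_cons, pow_succ', mul_assoc]
      refine (norm_mul_le _ _).trans (mul_le_mul (hgen x (h x (by simp)))
        (ih fun y hy => h y (by simp [hy])) (norm_nonneg _) (by linarith))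
  refine ⟨C, by linarith, fun g => ?_⟩
  obtain ⟨l, hl, hg, hlen⟩ := exists_list_length_eq_wordLength hS g
  rw [← hlen, ← hg]
  exact hlist l hl

/-- Growth t^n with t > 1 would force the word length of γ^n to grow linearly, with translation
number at least log t / (2 log C). -/
theorem IsDistorted.le_one_of_pow_le_norm {γ : Γ} (hγ : IsDistorted γ) {A : Type*}
    [SeminormedRing A] (ρ : Γ →* A) {t : ℝ} (h : ∀ n : ℕ, t ^ n ≤ ‖ρ (γ ^ n)‖) : t ≤ 1 := by
  obtain ⟨S, hS, h0⟩ := hγ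
  obtain ⟨C, hC, hbound⟩ := exists_norm_le_pow_wordLength hS ρ
  by_contra! ht
  have hlt : 0 < Real.log t := Real.log_pos ht
  have hlC : 0 < Real.log C := Real.log_pos hC
  -- The norm of 1 may be 0 in a seminormed ring; the maximum keeps the logarithm usable.
  set B : ℝ := max ‖(1 : A)‖ 1 with hB
  have hB1 : 1 ≤ B := le_max_right _ _
  have key : ∀ n : ℕ, n * Real.log t ≤
      wordLength (S : Set Γ) (γ ^ n) * Real.log C + Real.log B := by
    intro n
    have h1 : t ^ n ≤ C ^ wordLength (S : Set Γ) (γ ^ n) * B :=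
      (h n).trans ((hbound _).trans (by gcongr; exact le_max_left _ _))
    have h2 := Real.log_le_log (by positivity) h1
    rwa [Real.log_mul (by positivity) (by positivity), Real.log_pow, Real.log_pow] at h2
  -- Half of n log t absorbs the constant log B for large n, hence the factor 2.
  have hev : ∀ᶠ n : ℕ in Filter.atTop, Real.log t / (2 * Real.log C) ≤
      (wordLength (S : Set Γ) (γ ^ n) : ℝ) / (n : ℝ) := by
    filter_upwards [Filter.eventually_ge_atTop (⌈2 * Real.log B / Real.log t⌉₊ + 1)] with n hn
    have hn0 : (0 : ℝ) < n := by exact_mod_cast (Nat.succ_pos _).trans_le hn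
    have hn1 : 2 * Real.log B / Real.log t ≤ n :=
      (Nat.le_ceil _).trans (by exact_mod_cast (Nat.le_succ _).trans hn)
    rw [div_le_iff₀ hlt] at hn1
    rw [div_le_div_iff₀ (by positivity) hn0]
    nlinarith [key n]
  have hle : Real.log t / (2 * Real.log C) ≤ translationNumber (S : Set Γ) γ := by
    refine Filter.le_liminf_of_le ?_ hev
    -- A real `liminf` can be bounded below this way only if the quotients do not escape to
    -- infinity; they are at most the word length of γ.
    refine Filter.IsBoundedUnder.isCoboundedUnder_ge ?_
    refine Filter.isBoundedUnder_of ⟨(wordLength (S : Set Γ) γ : ℝ), fun n => ?_⟩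
    rcases Nat.eq_zero_or_pos n with rfl | hn
    · simp
    · rw [div_le_iff₀ (by exact_mod_cast hn), mul_comm]
      exact_mod_cast wordLength_pow_le hS γ n
  rw [h0] at hle
  have : 0 < Real.log t / (2 * Real.log C) := by positivity
  linarith

open Matrix in
attribute [local instance] Matrix.linftyOpNormedRing in
-- Applying σ to matrix entries gives a representation over K in which the image of an eigenvector
-- has eigenvalue σ z. The operator norm of γ^n is then at least ‖σ z‖^n.
theorem IsDistorted.norm_map_le_one_of_hasEigenvalue {γ : Γ} (hγ : IsDistorted γ)
    {F V K : Type*} [Field F] [AddCommGroup V] [Module F V] [FiniteDimensional F V]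
    [NormedField K] (τ : Γ →* Module.End F V) {z : F} (hz : (τ γ).HasEigenvalue z)
    (σ : F →+* K) : ‖σ z‖ ≤ 1 := by
  let b := Module.finBasis F V
  let ρ : Γ →* Matrix (Fin (Module.finrank F V)) (Fin (Module.finrank F V)) K :=
    (σ.mapMatrix.toMonoidHom.comp
      (LinearMap.toMatrixAlgEquiv b).toRingEquiv.toRingHom.toMonoidHom).comp τ
  obtain ⟨v, hv⟩ := hz.exists_hasEigenvector
  let w : Fin (Module.finrank F V) → K := fun i => σ (b.repr v i)
  have hw : w ≠ 0 := by
    intro h0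
    apply hv.2
    rw [← b.repr.map_eq_zero_iff]
    ext i
    exact (map_eq_zero σ).1 (congrFun h0 i)
  refine hγ.le_one_of_pow_le_norm ρ fun n => ?_
  have hpow : (τ (γ ^ n)) v = z ^ n • v := by
    rw [map_pow]
    exact hv.pow_apply n
  have hρ : ρ (γ ^ n) *ᵥ w = (σ z) ^ n • w := by
    have h1 : LinearMap.toMatrixAlgEquiv b (τ (γ ^ n)) *ᵥ b.repr v = b.repr (z ^ n • v) := by
      rw [← hpow]
      exact LinearMap.toMatrix_mulVec_repr b b _ v
    ext i
    have h2 := congrArg σ (congrFun h1 i)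
    rw [RingHom.map_mulVec, map_smul, Finsupp.smul_apply, smul_eq_mul, map_mul] at h2
    rw [Pi.smul_apply, smul_eq_mul, ← map_pow]
    exact h2
  have h3 := linfty_opNorm_mulVec (ρ (γ ^ n)) w
  rw [hρ, norm_smul, norm_pow] at h3
  exact le_of_mul_le_mul_right h3 (norm_pos_iff.2 hw)

theorem IsDistorted.exists_pow_eq_one_of_hasEigenvalue {γ : Γ} (hγ : IsDistorted γ)
    {V : Type*} [AddCommGroup V] [Module ℂ V] [FiniteDimensional ℂ V]
    (τ : Γ →* Module.End ℂ V) {z : ℂ} (hz : (τ γ).HasEigenvalue z) :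
    ∃ n : ℕ, 0 < n ∧ z ^ n = 1 := by
  refine exists_pow_eq_one_of_forall_norm_le_one (fun h0 => ?_)
    (hγ.norm_map_le_one_of_hasEigenvalue τ hz)
    (fun p _ => hγ.norm_map_le_one_of_hasEigenvalue τ hz)
  obtain ⟨v, hv⟩ := hz.exists_hasEigenvector
  have h1 : τ γ v = 0 := by rw [hv.apply_eq_smul, h0, zero_smul]
  apply hv.2
  calc v = (τ γ⁻¹ * τ γ) v := by rw [← map_mul, inv_mul_cancel, map_one]; rfl
    _ = 0 := by rw [Module.End.mul_apply, h1, map_zero]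

/-- A distorted element has finite order in every finite dimensional unitary representation. -/
theorem IsDistorted.exists_pow_map_eq_one {γ : Γ} (hγ : IsDistorted γ) {H : Type*}
    [NormedAddCommGroup H] [InnerProductSpace ℂ H] [FiniteDimensional ℂ H] (π : UnitaryRep Γ H) :
    ∃ n : ℕ, 0 < n ∧ π γ ^ n = 1 := by
  have : CompleteSpace H := FiniteDimensional.complete ℂ H
  let τ : Γ →* Module.End ℂ H :=
    { toFun := fun g => (π g).toLinearEquiv.toLinearMap
      map_one' := by rw [map_one]; rfl
      map_mul' := fun g h => by rw [map_mul]; rfl }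
  let u : unitary (H →L[ℂ] H) := Unitary.linearIsometryEquiv.symm (π γ)
  have hspec : ∀ z ∈ spectrum ℂ (u : H →L[ℂ] H), (τ γ).HasEigenvalue z := by
    intro z hz
    rw [Module.End.hasEigenvalue_iff_mem_spectrum]
    rw [← AlgEquiv.spectrum_eq (Module.End.toContinuousLinearMap H)]
    exact hz
  have hfin : (spectrum ℂ (u : H →L[ℂ] H)).Finite :=
    (τ γ).finite_hasEigenvalue.subset hspec
  choose! m hm0 hm using fun z hz => hγ.exists_pow_eq_one_of_hasEigenvalue τ (hspec z hz)
  refine ⟨∏ z ∈ hfin.toFinset, m z,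
    Finset.prod_pos fun z hz => hm0 z (hfin.mem_toFinset.1 hz), ?_⟩
  -- The functional calculus replaces diagonalization: the power function is 1 on the spectrum of
  -- the normal operator u.
  have hu : (u : H →L[ℂ] H) ^ (∏ z ∈ hfin.toFinset, m z) = 1 := by
    have hn : IsStarNormal (u : H →L[ℂ] H) := inferInstance
    rw [← cfc_pow_id (R := ℂ) (u : H →L[ℂ] H), ← cfc_const_one ℂ (u : H →L[ℂ] H)]
    refine cfc_congr fun z hz => ?_
    obtain ⟨k, hk⟩ := Finset.dvd_prod_of_mem m (hfin.mem_toFinset.2 hz)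
    change z ^ _ = 1
    rw [hk, pow_mul, hm z hz, one_pow]
  have hu' : u ^ (∏ z ∈ hfin.toFinset, m z) = 1 := Subtype.ext hu
  have := congrArg Unitary.linearIsometryEquiv hu'
  rw [map_pow, map_one] at this
  simpa [u] using this

end Distortion

end NFRC

namespace NFRC

/-! ### Representing measures -/

section Choquet

open MeasureTheory

variable {X : Type*} [TopologicalSpace X]

/-- The upper envelope at `x` of a continuous function `h` with respect to a space `A` of
continuous functions. -/
noncomputable def upperEnvelope (A : Submodule ℝ C(X, ℝ)) (x : X) (h : C(X, ℝ)) : ℝ :=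
  sInf ((fun a : C(X, ℝ) => a x) '' {a | a ∈ A ∧ h ≤ a})

variable {A : Submodule ℝ C(X, ℝ)}

theorem upperEnvelope_le (x : X) {a h : C(X, ℝ)} (ha : a ∈ A) (hha : h ≤ a) :
    upperEnvelope A x h ≤ a x :=
  csInf_le ⟨h x, by rintro _ ⟨b, hb, rfl⟩; exact hb.2 x⟩ ⟨a, ⟨ha, hha⟩, rfl⟩

variable [CompactSpace X]

/-- The constant ‖h‖ lies in A and majorizes h, so the infimum is over a nonempty set. -/
theorem le_upperEnvelope (hA : (1 : C(X, ℝ)) ∈ A) (x : X)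
    {h : C(X, ℝ)} {c : ℝ} (hc : ∀ a ∈ A, h ≤ a → c ≤ a x) :
    c ≤ upperEnvelope A x h := by
  refine le_csInf ?_ (by rintro _ ⟨a, ha, rfl⟩; exact hc a ha.1 ha.2)
  refine Set.Nonempty.image _ ⟨‖h‖ • (1 : C(X, ℝ)), A.smul_mem _ hA, fun y => ?_⟩
  simpa using (le_abs_self _).trans (h.norm_coe_le_norm y)

theorem exists_lt_of_upperEnvelope_lt (hA : (1 : C(X, ℝ)) ∈ A) (x : X)
    {h : C(X, ℝ)} {c : ℝ} (hc : upperEnvelope A x h < c) :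
    ∃ a ∈ A, h ≤ a ∧ a x < c := by
  by_contra! H
  exact hc.not_ge (le_upperEnvelope hA x H)

theorem upperEnvelope_add_le (hA : (1 : C(X, ℝ)) ∈ A) (x : X)
    (h k : C(X, ℝ)) :
    upperEnvelope A x (h + k) ≤ upperEnvelope A x h + upperEnvelope A x k := by
  refine le_of_forall_pos_le_add fun ε hε => ?_
  obtain ⟨a, haA, ha, hax⟩ := exists_lt_of_upperEnvelope_lt hA x
    (lt_add_of_pos_right (upperEnvelope A x h) (half_pos hε))
  obtain ⟨b, hbA, hb, hbx⟩ := exists_lt_of_upperEnvelope_lt hA x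
    (lt_add_of_pos_right (upperEnvelope A x k) (half_pos hε))
  have := upperEnvelope_le x (A.add_mem haA hbA) (add_le_add ha hb)
  rw [ContinuousMap.add_apply] at this
  linarith

theorem upperEnvelope_smul (hA : (1 : C(X, ℝ)) ∈ A) (x : X)
    {c : ℝ} (hc : 0 < c) (h : C(X, ℝ)) :
    upperEnvelope A x (c • h) = c * upperEnvelope A x h := by
  have key : ∀ {c : ℝ}, 0 < c → ∀ h : C(X, ℝ),
      upperEnvelope A x (c • h) ≤ c * upperEnvelope A x h := by
    intro c hc h
    rw [← div_le_iff₀' hc]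
    refine le_upperEnvelope hA x fun a ha hha => ?_
    rw [div_le_iff₀' hc]
    exact upperEnvelope_le x (A.smul_mem c ha) fun y => mul_le_mul_of_nonneg_left (hha y) hc.le
  refine le_antisymm (key hc h) ?_
  have := key (inv_pos.2 hc) (c • h)
  rw [smul_smul, inv_mul_cancel₀ hc.ne', one_smul] at this
  rwa [← le_inv_mul_iff₀ hc]

theorem upperEnvelope_zero (hA : (1 : C(X, ℝ)) ∈ A) (x : X) :
    upperEnvelope A x 0 = 0 := by
  have := upperEnvelope_smul hA x (c := 2) (by norm_num) 0
  rw [smul_zero] at this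
  linarith

/-- A positive functional which agrees with the evaluation at `x` on `A` and with the upper
envelope at `f`. -/
theorem exists_linearMap_eq_upperEnvelope (hA : (1 : C(X, ℝ)) ∈ A) (x : X)
    (f : C(X, ℝ)) :
    ∃ Λ : C(X, ℝ) →ₗ[ℝ] ℝ, (∀ a ∈ A, Λ a = a x) ∧ (∀ h, 0 ≤ h → 0 ≤ Λ h) ∧
      Λ f = upperEnvelope A x f := by
  have hdom : ∃ Λ : C(X, ℝ) →ₗ[ℝ] ℝ, Λ f = upperEnvelope A x f ∧
      ∀ h, Λ h ≤ upperEnvelope A x h := by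
    by_cases hf : f = 0
    · obtain ⟨Λ, -, hΛ⟩ := exists_extension_of_le_sublinear (⊥ : C(X, ℝ) →ₗ.[ℝ] ℝ)
        (upperEnvelope A x) (fun c hc h => upperEnvelope_smul hA x hc h)
        (upperEnvelope_add_le hA x) (by
          rintro ⟨y, hy⟩
          obtain rfl : y = 0 := (Submodule.mem_bot ℝ).1 hy
          change (0 : ℝ) ≤ upperEnvelope A x 0
          rw [upperEnvelope_zero hA])
      exact ⟨Λ, by rw [hf, map_zero, upperEnvelope_zero hA], hΛ⟩
    · obtain ⟨Λ, hΛf, hΛ⟩ := exists_extension_of_le_sublinear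
        (LinearPMap.mkSpanSingleton (K := ℝ) f (upperEnvelope A x f) hf)
        (upperEnvelope A x) (fun c hc h => upperEnvelope_smul hA x hc h)
        (upperEnvelope_add_le hA x) (by
          rintro ⟨y, hy⟩
          obtain ⟨c, rfl⟩ := Submodule.mem_span_singleton.1 hy
          rw [LinearPMap.mkSpanSingleton'_apply, RingHom.id_apply, smul_eq_mul]
          change c * upperEnvelope A x f ≤ upperEnvelope A x (c • f)
          rcases lt_trichotomy c 0 with hc | rfl | hc
          -- For negative c, domination on the line through f follows from subadditivity applied to
          -- c f + (-c) f = 0.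
          · have h1 := upperEnvelope_add_le hA x (c • f) ((-c) • f)
            rw [← add_smul, add_neg_cancel, zero_smul, upperEnvelope_zero hA,
              upperEnvelope_smul hA x (neg_pos.2 hc)] at h1
            linarith
          · rw [zero_smul, upperEnvelope_zero hA, zero_mul]
          · exact (upperEnvelope_smul hA x hc f).ge)
      refine ⟨Λ, ?_, hΛ⟩
      rw [hΛf ⟨f, Submodule.mem_span_singleton_self f⟩]
      exact LinearPMap.mkSpanSingleton_apply ℝ ..
  obtain ⟨Λ, hΛf, hΛ⟩ := hdom
  -- Domination at a and -a pins Λ on A; domination at -h, which is majorized by 0 ∈ A, gives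
  -- positivity.
  refine ⟨Λ, fun a ha => le_antisymm ((hΛ a).trans (upperEnvelope_le x ha le_rfl)) ?_,
    fun h hh => ?_, hΛf⟩
  · have := (hΛ (-a)).trans (upperEnvelope_le x (A.neg_mem ha) le_rfl)
    rw [map_neg, ContinuousMap.neg_apply] at this
    linarith
  · have := (hΛ (-h)).trans (upperEnvelope_le x A.zero_mem (neg_nonpos.2 hh))
    rw [map_neg, ContinuousMap.zero_apply] at this
    linarith

/-- A version of Choquet's theorem. -/
theorem exists_measure_forall_integral_eq [T2Space X] [MeasurableSpace X] [BorelSpace X]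
    (hA : (1 : C(X, ℝ)) ∈ A) (x : X) (f : C(X, ℝ)) :
    ∃ μ : Measure X, IsProbabilityMeasure μ ∧ (∀ a ∈ A, ∫ y, a y ∂μ = a x) ∧
      ∀ᵐ y ∂μ, ∀ ε > 0, ∃ a ∈ A, f ≤ a ∧ a y < f y + ε := by
  obtain ⟨Λ, hΛA, hΛ, hΛf⟩ := exists_linearMap_eq_upperEnvelope hA x f
  let Λ' : CompactlySupportedContinuousMap X ℝ →ₚ[ℝ] ℝ :=
    PositiveLinearMap.mk₀
      { toFun := fun h => Λ h.toContinuousMap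
        map_add' := fun h k => Λ.map_add _ _
        map_smul' := fun c h => Λ.map_smul _ _ }
      (fun h hh => hΛ _ hh)
  let μ := RealRMK.rieszMeasure Λ'
  have hμ : ∀ h : C(X, ℝ), ∫ y, h y ∂μ = Λ h := fun h =>
    RealRMK.integral_rieszMeasure Λ' (CompactlySupportedContinuousMap.continuousMapEquiv h)
  have hfin : IsFiniteMeasure μ := inferInstance
  have hone : IsProbabilityMeasure μ := by
    have h1 := hμ 1
    rw [hΛA 1 hA] at h1
    simp only [ContinuousMap.one_apply, integral_const, smul_eq_mul, mul_one] at h1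
    exact ⟨(ENNReal.toReal_eq_one_iff _).1 h1⟩
  have hint : ∀ h : C(X, ℝ), Integrable h μ := fun h =>
    h.continuous.integrable_of_hasCompactSupport (HasCompactSupport.of_compactSpace h)
  refine ⟨μ, hone, fun a ha => (hμ a).trans (hΛA a ha), ?_⟩
  -- Since μ integrates a to a x and f to its envelope at x, the functions a n - f ≥ 0 have integral
  -- at most 2^(-n). Markov's inequality then shows that their infimum over n is 0 almost
  -- everywhere.
  have hex : ∀ n : ℕ, ∃ a ∈ A, f ≤ a ∧ a x < upperEnvelope A x f + (1 / 2) ^ n := fun n =>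
    exists_lt_of_upperEnvelope_lt hA x (lt_add_of_pos_right _ (by positivity))
  choose a haA hfa hax using hex
  have hnull : ∀ m : ℕ, ∀ᵐ y ∂μ, ∃ n, a n y - f y < 1 / ((m : ℝ) + 1) := by
    intro m
    have hm : (0 : ℝ) < 1 / ((m : ℝ) + 1) := by positivity
    have hbound : ∀ n, μ.real {y | ∀ n, 1 / ((m : ℝ) + 1) ≤ a n y - f y} * (1 / ((m : ℝ) + 1)) ≤
        (1 / 2) ^ n := by
      intro n
      have h1 : ∫ y, (a n - f) y ∂μ ≤ (1 / 2) ^ n := by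
        rw [hμ, map_sub, hΛA _ (haA n), hΛf]
        linarith [hax n]
      refine le_trans ?_ h1
      have h2 := mul_meas_ge_le_integral_of_nonneg (μ := μ) (f := (a n - f : C(X, ℝ)))
        (Filter.Eventually.of_forall fun y => sub_nonneg.2 (hfa n y)) (hint _)
        (1 / ((m : ℝ) + 1))
      refine le_trans ?_ h2
      rw [mul_comm]
      refine mul_le_mul_of_nonneg_left (measureReal_mono fun y hy => hy n) hm.le
    have hle : μ.real {y | ∀ n, 1 / ((m : ℝ) + 1) ≤ a n y - f y} * (1 / ((m : ℝ) + 1)) ≤ 0 :=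
      ge_of_tendsto' (tendsto_pow_atTop_nhds_zero_of_lt_one (by norm_num) (by norm_num)) hbound
    have hzero : μ.real {y | ∀ n, 1 / ((m : ℝ) + 1) ≤ a n y - f y} = 0 :=
      le_antisymm (nonpos_of_mul_nonpos_left hle hm) measureReal_nonneg
    rw [measureReal_eq_zero_iff] at hzero
    rw [ae_iff]
    convert hzero using 2
    ext y
    simp
  filter_upwards [ae_all_iff.2 hnull] with y hy ε hε
  obtain ⟨m, hm⟩ := exists_nat_one_div_lt hε
  obtain ⟨n, hn⟩ := hy m
  exact ⟨a n, haA n, hfa n, by linarith⟩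

end Choquet

end NFRC

namespace NFRC

/-! ### Decomposition of characters into extremal characters -/

section Decomposition

open MeasureTheory

variable {Γ : Type*} [Group Γ]

/-- Testing on the pair 1, g with coefficients ±1 and ±i bounds the real and imaginary parts by 1.
The non-sharp constant 2 suffices for compactness and domination. -/
theorem IsPosDef.norm_le_two {φ : Γ → ℂ} (hφ : IsPosDef φ) (h1 : φ 1 = 1) (g : Γ) :
    ‖φ g‖ ≤ 2 := by
  have hinv := hφ.map_inv g
  have key : ∀ c : ℂ, 0 ≤ (φ 1 + c * φ g + (conj c * φ g⁻¹ + conj c * c * φ 1)).re := by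
    intro c
    have := (Complex.le_def.1 (hφ 2 ![1, g] ![1, c])).1
    simpa [Fin.sum_univ_two] using this
  have k1 := key 1
  have k2 := key (-1)
  have k3 := key Complex.I
  have k4 := key (-Complex.I)
  simp [hinv, h1] at k1 k2 k3 k4
  have hre : |(φ g).re| ≤ 1 := abs_le.2 ⟨by linarith, by linarith⟩
  have him : |(φ g).im| ≤ 1 := abs_le.2 ⟨by linarith, by linarith⟩
  linarith [Complex.norm_le_abs_re_add_abs_im (φ g)]

theorem isClosed_setOf_isPosDef : IsClosed {φ : Γ → ℂ | IsPosDef φ} := by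
  simp only [IsPosDef, Set.ofPred_forall]
  refine isClosed_iInter fun n => isClosed_iInter fun g => isClosed_iInter fun α => ?_
  exact isClosed_le continuous_const (by fun_prop)

variable (Γ) in
/-- The compact convex set of all characters. -/
def characterSet : Set (Γ → ℂ) :=
  {φ | IsPosDef φ ∧ (∀ g h : Γ, φ (h * g * h⁻¹) = φ g) ∧ φ 1 = 1}

instance : CompactSpace (characterSet Γ) := by
  rw [← isCompact_iff_compactSpace]
  refine (isCompact_univ_pi fun _ : Γ => isCompact_closedBall (0 : ℂ) 2).of_isClosed_subset ?_ ?_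
  · refine isClosed_setOf_isPosDef.inter (IsClosed.inter ?_ ?_)
    · change IsClosed {φ : Γ → ℂ | ∀ g h : Γ, φ (h * g * h⁻¹) = φ g}
      simp only [Set.ofPred_forall]
      exact isClosed_iInter fun g => isClosed_iInter fun h =>
        isClosed_eq (continuous_apply _) (continuous_apply _)
    · exact isClosed_eq (continuous_apply _) continuous_const
  · intro φ hφ g _
    rw [mem_closedBall_zero_iff]
    exact hφ.1.norm_le_two hφ.2.2 g

/-- A member of `characterSet Γ` as a character. -/
def GroupCharacter.ofCharacterSet (χ : characterSet Γ) : GroupCharacter Γ :=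
  ⟨χ.1, χ.2.1, χ.2.2.1, χ.2.2.2⟩

/-- A character as a member of `characterSet Γ`. -/
def GroupCharacter.toCharacterSet (φ : GroupCharacter Γ) : characterSet Γ :=
  ⟨φ, φ.posDef, φ.conj_invariant, φ.normalized⟩

theorem norm_apply_le_two_of_characterSet (χ : characterSet Γ) (g : Γ) : ‖χ.1 g‖ ≤ 2 :=
  χ.2.1.norm_le_two χ.2.2.2 g

variable (Γ) in
/-- The continuous affine functions on the set of characters. -/
def affineFunctions : Submodule ℝ C(characterSet Γ, ℝ) where
  carrier := {h | ∀ (u v w : characterSet Γ) (a : ℝ), 0 < a → a < 1 →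
    (∀ g, w.1 g = (a : ℂ) * u.1 g + (1 - (a : ℂ)) * v.1 g) → h w = a * h u + (1 - a) * h v}
  add_mem' {h k} hh hk u v w a h0 h1 hw := by
    rw [ContinuousMap.add_apply, ContinuousMap.add_apply, ContinuousMap.add_apply,
      hh u v w a h0 h1 hw, hk u v w a h0 h1 hw]
    ring
  zero_mem' u v w a h0 h1 hw := by simp
  smul_mem' c h hh u v w a h0 h1 hw := by
    rw [ContinuousMap.smul_apply, ContinuousMap.smul_apply, ContinuousMap.smul_apply,
      hh u v w a h0 h1 hw]
    simp only [smul_eq_mul]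
    ring

theorem one_mem_affineFunctions : (1 : C(characterSet Γ, ℝ)) ∈ affineFunctions Γ :=
  fun u v w a h0 h1 hw => by simp

/-- The real part of the evaluation at `g`. -/
def evalRe (g : Γ) : C(characterSet Γ, ℝ) :=
  ⟨fun χ => (χ.1 g).re, Complex.continuous_re.comp
    ((continuous_apply g).comp continuous_subtype_val)⟩

/-- The imaginary part of the evaluation at `g`. -/
def evalIm (g : Γ) : C(characterSet Γ, ℝ) :=
  ⟨fun χ => (χ.1 g).im, Complex.continuous_im.comp
    ((continuous_apply g).comp continuous_subtype_val)⟩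

theorem evalRe_mem_affineFunctions (g : Γ) : evalRe g ∈ affineFunctions Γ :=
  fun u v w a h0 h1 hw => by simp [evalRe, hw g]

theorem evalIm_mem_affineFunctions (g : Γ) : evalIm g ∈ affineFunctions Γ :=
  fun u v w a h0 h1 hw => by simp [evalIm, hw g]

/-- There is a continuous strictly convex function on the set of characters. -/
theorem exists_strictConvex_continuousMap [Countable Γ] : ∃ f : C(characterSet Γ, ℝ),
    ∀ (u v w : characterSet Γ) (a : ℝ), 0 < a → a < 1 → u ≠ v →
      (∀ g, w.1 g = (a : ℂ) * u.1 g + (1 - (a : ℂ)) * v.1 g) →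
      f w < a * f u + (1 - a) * f v := by
  let _ := Encodable.ofCountable Γ
  -- With positive summable weights c, the function is χ ↦ ∑ c g |χ g|²; its convexity defect is a(1
  -- - a) ∑ c g |u g - v g|².
  obtain ⟨c, hc0, s, hc, -⟩ := posSumOfEncodable (ε := 1) one_pos Γ
  have hbd : ∀ (χ : characterSet Γ) (g : Γ), ‖c g * ‖χ.1 g‖ ^ 2‖ ≤ c g * 4 := by
    intro χ g
    rw [Real.norm_of_nonneg (mul_nonneg (hc0 g).le (by positivity))]
    refine mul_le_mul_of_nonneg_left ?_ (hc0 g).le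
    nlinarith [norm_apply_le_two_of_characterSet χ g, norm_nonneg (χ.1 g)]
  have hs4 : Summable fun g => c g * 4 := hc.summable.mul_right 4
  have hsum : ∀ χ : characterSet Γ, Summable fun g => c g * ‖χ.1 g‖ ^ 2 := fun χ =>
    Summable.of_norm_bounded hs4 (hbd χ)
  refine ⟨⟨fun χ => ∑' g, c g * ‖χ.1 g‖ ^ 2, ?_⟩, ?_⟩
  · refine continuous_tsum (fun g => ?_) hs4 fun g χ => hbd χ g
    exact continuous_const.mul
      (((continuous_apply g).comp continuous_subtype_val).norm.pow 2)
  · intro u v w a h0 h1 huv hw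
    have hid : ∀ g, c g * ‖w.1 g‖ ^ 2 =
        a * (c g * ‖u.1 g‖ ^ 2) + (1 - a) * (c g * ‖v.1 g‖ ^ 2) -
          a * (1 - a) * (c g * ‖u.1 g - v.1 g‖ ^ 2) := by
      intro g
      rw [hw g, Complex.sq_norm, Complex.sq_norm, Complex.sq_norm, Complex.sq_norm]
      simp [Complex.normSq_apply]
      ring
    have hne : ∃ g, u.1 g ≠ v.1 g := by
      by_contra! h
      exact huv (Subtype.ext (funext h))
    obtain ⟨g₀, hg₀⟩ := hne
    change ∑' g, c g * ‖w.1 g‖ ^ 2 <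
      a * ∑' g, c g * ‖u.1 g‖ ^ 2 + (1 - a) * ∑' g, c g * ‖v.1 g‖ ^ 2
    rw [← tsum_mul_left, ← tsum_mul_left,
      ← ((hsum u).mul_left a).tsum_add ((hsum v).mul_left (1 - a))]
    have hpos : 0 < a * (1 - a) := mul_pos h0 (by linarith)
    refine Summable.tsum_lt_tsum (i := g₀) (fun g => ?_) ?_ (hsum w)
      (((hsum u).mul_left a).add ((hsum v).mul_left (1 - a)))
    · rw [hid g]
      have : 0 ≤ a * (1 - a) * (c g * ‖u.1 g - v.1 g‖ ^ 2) :=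
        mul_nonneg hpos.le (mul_nonneg (hc0 g).le (by positivity))
      linarith
    · rw [hid g₀]
      have : 0 < a * (1 - a) * (c g₀ * ‖u.1 g₀ - v.1 g₀‖ ^ 2) :=
        mul_pos hpos (mul_pos (hc0 g₀) (pow_pos (norm_pos_iff.2 (sub_ne_zero.2 hg₀)) 2))
      linarith

/-- Every character is an average of extremal characters. -/
theorem GroupCharacter.exists_measure_isExtremal [Countable Γ] (φ : GroupCharacter Γ) :
    ∃ μ : Measure (characterSet Γ), IsProbabilityMeasure μ ∧
      (∀ g, ∫ χ, χ.1 g ∂μ = φ g) ∧ ∀ᵐ χ ∂μ, (GroupCharacter.ofCharacterSet χ).IsExtremal := by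
  obtain ⟨f, hf⟩ := exists_strictConvex_continuousMap (Γ := Γ)
  obtain ⟨μ, hμ, hint, hae⟩ :=
    exists_measure_forall_integral_eq one_mem_affineFunctions φ.toCharacterSet f
  refine ⟨μ, hμ, fun g => ?_, ?_⟩
  · have hi : Integrable (fun χ : characterSet Γ => χ.1 g) μ :=
      ((continuous_apply g).comp continuous_subtype_val).integrable_of_hasCompactSupport
        (HasCompactSupport.of_compactSpace _)
    apply Complex.ext
    · exact (Complex.reCLM.integral_comp_comm hi).symm.trans (hint _ (evalRe_mem_affineFunctions g))
    · exact (Complex.imCLM.integral_comp_comm hi).symm.trans (hint _ (evalIm_mem_affineFunctions g))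
  · filter_upwards [hae] with w hw
    rintro ⟨u, v, a, h0, h1, huv, h⟩
    have huv' : u.toCharacterSet ≠ v.toCharacterSet := fun h =>
      huv (congrArg GroupCharacter.ofCharacterSet h)
    have hlt := hf u.toCharacterSet v.toCharacterSet w a h0 h1 huv' h
    -- Take ε to be the strict convexity gap. The affine k ≥ f then has k w < a f u + (1 - a) f v ≤
    -- a k u + (1 - a) k v = k w.
    obtain ⟨k, hk, hfk, hkw⟩ := hw _ (sub_pos.2 hlt)
    rw [hk u.toCharacterSet v.toCharacterSet w a h0 h1 h] at hkw
    have hu : a * f _ ≤ a * k _ := mul_le_mul_of_nonneg_left (hfk u.toCharacterSet) h0.le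
    have hv : (1 - a) * f _ ≤ (1 - a) * k _ :=
      mul_le_mul_of_nonneg_left (hfk v.toCharacterSet) (sub_pos.2 h1).le
    linarith

end Decomposition

/-! ### Non-factorizability of the regular character -/

section Main

open MeasureTheory Filter Topology

variable {Γ : Type*} [Group Γ]

/-- The value φ g is the matrix coefficient of g at the GNS vector δ_1, which has norm 1. -/
theorem apply_eq_one_of_gnsRep_eq_one {φ : Γ → ℂ} (hφ : IsPosDef φ) (h1 : φ 1 = 1) {g : Γ}
    (hg : gnsRep φ hφ g = 1) : φ g = 1 := by
  let x : PreGNS φ hφ := (Finsupp.single (1 : Γ) (1 : ℂ) : Γ →₀ ℂ)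
  have h2 : gnsRep φ hφ g (x : GNSSpace φ hφ) = ((preGnsRep φ hφ g x : PreGNS φ hφ) :
      GNSSpace φ hφ) := completionIso_coe _ x
  rw [hg] at h2
  have h3 : inner ℂ (x : GNSSpace φ hφ) (x : GNSSpace φ hφ) =
      inner ℂ (x : GNSSpace φ hφ) ((preGnsRep φ hφ g x : PreGNS φ hφ) : GNSSpace φ hφ) :=
    congrArg (inner ℂ (x : GNSSpace φ hφ)) h2
  rw [UniformSpace.Completion.inner_coe, UniformSpace.Completion.inner_coe] at h3
  have h4 : gnsForm φ (Finsupp.single 1 1) (Finsupp.single 1 1) =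
      gnsForm φ (Finsupp.single 1 1)
        (Finsupp.domLCongr (R := ℂ) (Equiv.mulLeft g) (Finsupp.single 1 1)) := h3
  simpa [gnsForm, h1, Finsupp.domLCongr_apply, Finsupp.domCongr_apply] using h4.symm

theorem IsCharfinite.eq_deltaOne_or_isFinite (hΓ : IsCharfinite Γ)
    (hrad : amenableRadical Γ = ⊥) {φ : GroupCharacter Γ} (hφ : φ.IsExtremal) :
    (φ : Γ → ℂ) = deltaOne Γ ∨ φ.IsFinite := by
  rcases hΓ.supported_or_amenable φ hφ with h | h
  · left
    ext g
    by_cases hg : g = 1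
    · simp [deltaOne, hg, φ.normalized]
    · rw [h g (by rwa [hrad, Subgroup.mem_bot])]
      simp [deltaOne, hg]
  · exact Or.inr (hΓ.amenable_finite φ hφ h.1)

/-- The order of γ in the GNS representation depends on φ, but it divides k! for all large k, so one
sequence of powers serves all finite characters. -/
theorem GroupCharacter.IsFinite.eventually_pow_factorial_eq_one {φ : GroupCharacter Γ}
    (hφ : φ.IsFinite) {γ : Γ} (hγ : IsDistorted γ) :
    ∀ᶠ k : ℕ in atTop, φ (γ ^ k.factorial) = 1 := by
  have : FiniteDimensional ℂ (GNSSpace φ.toFun φ.posDef) := hφ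
  obtain ⟨n, hn, h⟩ := hγ.exists_pow_map_eq_one (gnsRep φ.toFun φ.posDef)
  filter_upwards [eventually_ge_atTop n] with k hk
  obtain ⟨m, hm⟩ := Nat.dvd_factorial hn hk
  refine apply_eq_one_of_gnsRep_eq_one φ.posDef φ.normalized ?_
  rw [map_pow, hm, pow_mul, h, one_pow]

/-- Along the factorial powers of a distorted element, a character other than the regular one
has a nonzero limit. -/
theorem IsCharfinite.exists_tendsto_pow_factorial (hΓ : IsCharfinite Γ)
    (hrad : amenableRadical Γ = ⊥) {γ : Γ} (hγ : IsDistorted γ) (hinf : ¬ IsOfFinOrder γ)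
    {φ : GroupCharacter Γ} (hφ : (φ : Γ → ℂ) ≠ deltaOne Γ) :
    ∃ c : ℂ, c ≠ 0 ∧ Tendsto (fun k : ℕ => φ (γ ^ k.factorial)) atTop (𝓝 c) := by
  have := hΓ.countable
  obtain ⟨μ, hμ, hint, hext⟩ := φ.exists_measure_isExtremal
  let D : Set (characterSet Γ) := {χ | χ.1 = deltaOne Γ}ᶜ
  have hD : MeasurableSet D :=
    (isClosed_eq continuous_subtype_val continuous_const).measurableSet.compl
  have hpow : ∀ k : ℕ, γ ^ k.factorial ≠ 1 := fun k hk =>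
    hinf (isOfFinOrder_iff_pow_eq_one.2 ⟨_, k.factorial_pos, hk⟩)
  -- The limit is the mass of the extremal characters other than δ_e; were it zero, averaging would
  -- give φ = δ_e.
  refine ⟨(μ.real D : ℂ), ?_, ?_⟩
  · intro h0
    apply hφ
    have hμD : μ D = 0 := by
      rw [← measureReal_eq_zero_iff]
      exact_mod_cast h0
    have hae : ∀ᵐ χ ∂μ, χ.1 = deltaOne Γ := hμD
    ext g
    rw [← hint g, integral_congr_ae (hae.mono fun χ hχ => congrFun hχ g)]
    simp
  · have hlim : Tendsto (fun k : ℕ => ∫ χ, χ.1 (γ ^ k.factorial) ∂μ) atTop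
        (𝓝 (∫ χ, D.indicator (fun _ => (1 : ℂ)) χ ∂μ)) := by
      -- For almost every χ the values at γ^(k!) are eventually constant: 0 at δ_e and 1 at finite
      -- characters.
      refine tendsto_integral_of_dominated_convergence (fun _ => 2) (fun k => ?_)
        (integrable_const _) (fun k => Eventually.of_forall fun χ =>
          norm_apply_le_two_of_characterSet χ _) ?_
      · exact ((continuous_apply _).comp continuous_subtype_val).aestronglyMeasurable
      · filter_upwards [hext] with χ hχ
        by_cases hδ : χ.1 = deltaOne Γ
        · rw [Set.indicator_of_notMem (by simpa [D] using hδ)]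
          refine tendsto_const_nhds.congr fun k => ?_
          rw [hδ, deltaOne, if_neg (hpow k)]
        · rw [Set.indicator_of_mem (by simpa [D] using hδ)]
          have hfin := (hΓ.eq_deltaOne_or_isFinite hrad hχ).resolve_left hδ
          refine tendsto_const_nhds.congr' ?_
          filter_upwards [hfin.eventually_pow_factorial_eq_one hγ] with k hk
          exact hk.symm
    simp_rw [hint] at hlim
    rw [integral_indicator_const _ hD] at hlim
    simpa using hlim

end Main

end NFRC

theorem mainTheorem9 {Γ : Type*} [Group Γ] [Group.FG Γ]
    (hΓ : NFRC.IsCharfinite Γ)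
    (hrad : NFRC.amenableRadical Γ = ⊥)
    (γ : Γ) (hγ : NFRC.IsDistorted γ) (hinf : ¬ IsOfFinOrder γ) :
    NFRC.HasNonFactorizableRegularCharacter Γ := by
  intro φ ψ h
  by_contra! hne
  obtain ⟨c, hc, hφ⟩ := hΓ.exists_tendsto_pow_factorial hrad hγ hinf hne.1
  obtain ⟨d, hd, hψ⟩ := hΓ.exists_tendsto_pow_factorial hrad hγ hinf hne.2
  refine mul_ne_zero hc hd (tendsto_nhds_unique (hφ.mul hψ) ?_)
  refine tendsto_const_nhds.congr fun k => (h _ fun hk => ?_).symm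
  exact hinf (isOfFinOrder_iff_pow_eq_one.2 ⟨_, k.factorial_pos, hk⟩)
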